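/- For $a,b>0$ and real $r\ne 1$ let $$C_r(a,b)=\Big(\frac{b^r+a^r}{b+a}\Big)^{\frac1{r-1}},$$ and, taking limits, let $C_1(a,b)=\big(b^b a^a\big)^{\frac1{b+a}}$, $C_{+\infty}(a,b)=\max(a,b)$ and $C_{-\infty}(a,b)=\min(a,b)$. Let $r\in[0,+\infty)$ and let $a,b>0$ with $a\neq b$. Then $$C_{+\infty}(a,b)\,C_r(a,b)+C_{-\infty}(a,b)\,C_{-r}(a,b)<a^2+b^2.$$ -/

import Mathlib

/-- The generalized inverse harmonic mean `C_r(a, b)` of two positive numbers `a, b`, for an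
extended real parameter `r`: it is `((b ^ r + a ^ r) / (b + a)) ^ (1 / (r - 1))` for real `r ≠ 1`,
and at `r = 1`, `r = +∞`, `r = -∞` it is the limit of this expression, which is
`(b ^ b * a ^ a) ^ (1 / (b + a))`, `max a b`, `min a b`, respectively. -/
noncomputable def genInvHarmonicMean (r : EReal) (a b : ℝ) : ℝ :=
  if r = ⊤ then max a b
  else if r = ⊥ then min a b
  else if r = 1 then (b ^ b * a ^ a) ^ (1 / (b + a))
  else ((b ^ r.toReal + a ^ r.toReal) / (b + a)) ^ (1 / (r.toReal - 1))

/-! By symmetry and homogeneity, take means of `x < 1` and `1`. If `r ≤ 2`, then `C_r ≤ C_2` and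
`C_{-r} ≤ C_0 < C_2`, while `(1 + x) * C_2 = 1 + x ^ 2`.

If `r ≥ 2`, put `x = w⁻²`, `V = w ^ (2r)`, `y = x ^ 2`. Then `C_r = ρ ^ (-1/(r-1))` and `C_{-r} = x
* b` with `b = (w² ρ) ^ (1/(r+1))`, so the claim is `C_r < Y` for `Y = 1 + y - y * b`. Applying `t
log t ≥ t - 1` to `Y` and `b` makes this linear in `log ρ` and `log w` (`invHarmonic_rpow_lt`).
AM-GM for `b`, rational bounds for the logarithms and Bernoulli for `V` leave a polynomial
inequality (`invHarmonic_polynomial_pos`). -/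

set_option maxRecDepth 20000 in
theorem invHarmonic_polynomial_pos {s k q : ℝ} (hs : 0 < s) (hk : 0 ≤ k) (hq : 0 ≤ q) (w r V : ℝ)
    (hw : w = 1 + s) (hr : r = 2 + k) (hV : V = (1 + r / 2 * (w ^ 2 - 1)) ^ 2 + q) :
    ((2 * w + r - 2) * (w ^ 2 * (V + 1)) + (w ^ 2 + 1) * V) *
        (4 * r * (V - w ^ 2) * w + (r - 1) * (w ^ 2 - 1) * (2 * w ^ 2 * V + V + w ^ 2)) <
      2 * (V - w ^ 2) * (r + 1) ^ 2 * (w ^ 4 + 1) * (w ^ 2 * (V + 1)) * w := by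
  subst hV hw hr
  rw [← sub_pos]
  -- With this square subtracted, the difference expands in `s`, `k`, `q` with no negative
  -- coefficients.
  have h : 0 ≤ 4 * k * q * (1 - s * k) ^ 2 := by positivity
  refine lt_of_le_of_lt h (sub_pos.1 ?_)
  ring_nf
  positivity

/-- The bounds `2(ρ-1)/(ρ+1) ≤ log ρ` and `2 log w ≤ w - 1/w` reduce this to the polynomial
inequality. -/
theorem invHarmonic_log_ineq {w r V : ℝ} (hw : 1 < w) (hr : 2 ≤ r)
    (hV : (1 + r / 2 * (w ^ 2 - 1)) ^ 2 ≤ V) (ρ : ℝ)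
    (hρ : ρ = (w ^ 2 + 1) * V / (w ^ 2 * (V + 1))) :
    0 < Real.log ρ ∧ (2 * w + ρ + (r - 2)) * (2 * r * Real.log ρ + (r - 1) * (2 * Real.log w)) <
      Real.log ρ * (r + 1) ^ 2 * (w ^ 4 + 1) := by
  have key := invHarmonic_polynomial_pos (sub_pos.2 hw) (sub_nonneg.2 hr) (sub_nonneg.2 hV) w r V
    (by ring) (by ring) (by ring)
  have hw0 : 0 < w := by linarith
  have hVX : w ^ 2 < V := by
    have : 0 < w ^ 2 - 1 := by nlinarith
    nlinarith [mul_nonneg (sub_nonneg.2 hr) this.le, sq_nonneg (r / 2 * (w ^ 2 - 1))]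
  have hV0 : 0 < V := lt_trans (by positivity) hVX
  have hD : 0 < 2 * w ^ 2 * V + V + w ^ 2 := by positivity
  set m := 2 * (V - w ^ 2) / (2 * w ^ 2 * V + V + w ^ 2) with hm
  have hm0 : 0 < m := div_pos (by linarith) hD
  have hρ0 : 0 < ρ := by rw [hρ]; positivity
  have hml : m ≤ Real.log ρ := by
    have h1 : 0 ≤ ρ - 1 := by
      rw [hρ, sub_nonneg, one_le_div (by positivity)]; linarith
    have h2 := Real.le_log_one_add_of_nonneg h1
    have h3 : 2 * (ρ - 1) / (ρ - 1 + 2) = m := by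
      have : ρ - 1 + 2 ≠ 0 := by linarith
      rw [hm, div_eq_div_iff this hD.ne', hρ]
      field_simp
      ring
    rwa [h3, add_sub_cancel] at h2
  have hlw0 : 0 < Real.log w := Real.log_pos hw
  have hlw : 2 * Real.log w ≤ (w ^ 2 - 1) / w := by
    have := Real.self_le_sinh_iff.2 hlw0.le
    rw [Real.sinh_log hw0] at this
    calc 2 * Real.log w ≤ w - w⁻¹ := by linarith
      _ = _ := by field_simp
  have hpos : 0 < 2 * w + ρ + (r - 2) := by linarith
  have key' : (2 * w + ρ + (r - 2)) * (2 * r * m + (r - 1) * ((w ^ 2 - 1) / w)) <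
      m * (r + 1) ^ 2 * (w ^ 4 + 1) := by
    have hE : 0 < (2 * w ^ 2 * V + V + w ^ 2) * (w ^ 2 * (V + 1)) * w := by positivity
    refine lt_of_mul_lt_mul_right ?_ hE.le
    have e1 : (2 * w + ρ + (r - 2)) * (2 * r * m + (r - 1) * ((w ^ 2 - 1) / w)) *
        ((2 * w ^ 2 * V + V + w ^ 2) * (w ^ 2 * (V + 1)) * w) =
        ((2 * w + r - 2) * (w ^ 2 * (V + 1)) + (w ^ 2 + 1) * V) *
        (4 * r * (V - w ^ 2) * w + (r - 1) * (w ^ 2 - 1) * (2 * w ^ 2 * V + V + w ^ 2)) := by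
      rw [hm, hρ]
      field_simp
      ring
    have e2 : m * (r + 1) ^ 2 * (w ^ 4 + 1) *
        ((2 * w ^ 2 * V + V + w ^ 2) * (w ^ 2 * (V + 1)) * w) =
        2 * (V - w ^ 2) * (r + 1) ^ 2 * (w ^ 4 + 1) * (w ^ 2 * (V + 1)) * w := by
      rw [hm]
      field_simp
    rw [e1, e2]
    exact key
  have hl0 : 0 < Real.log ρ := hm0.trans_le hml
  refine ⟨hl0, ?_⟩
  have key2 : (2 * w + ρ + (r - 2)) * (2 * r * m + (r - 1) * (2 * Real.log w)) <
      m * (r + 1) ^ 2 * (w ^ 4 + 1) := by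
    refine lt_of_le_of_lt ?_ key'
    have : 0 ≤ r - 1 := by linarith
    gcongr
  set N := (2 * w + ρ + (r - 2)) * ((r - 1) * (2 * Real.log w)) with hN
  have hN0 : 0 ≤ N := by
    have : 0 ≤ r - 1 := by linarith
    positivity
  set K := (r + 1) ^ 2 * (w ^ 4 + 1) - (2 * w + ρ + (r - 2)) * (2 * r) with hK
  have hNK : N < m * K := by rw [hN, hK]; linarith
  -- `log ρ` occurs on both sides; its net coefficient `K` must be positive for `m` to be replaced
  -- by `log ρ`. This follows from `0 ≤ N < m * K`.
  have hK0 : 0 < K := pos_of_mul_pos_right (hN0.trans_lt hNK) hm0.le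
  have := hNK.trans_le (mul_le_mul_of_nonneg_right hml hK0.le)
  rw [hN, hK] at this
  linarith

/-- If `w > 1` and `V` dominates `(1 + r / 2 * (w ^ 2 - 1)) ^ 2`, then the inequality between the
normalized means of parameters `r` and `-r` of `1` and `w⁻²` holds. -/
theorem invHarmonic_rpow_lt {w r V : ℝ} (hw : 1 < w) (hr : 2 ≤ r)
    (hV : (1 + r / 2 * (w ^ 2 - 1)) ^ 2 ≤ V) (ρ : ℝ)
    (hρ : ρ = (w ^ 2 + 1) * V / (w ^ 2 * (V + 1))) :
    ρ⁻¹ ^ (1 / (r - 1)) + (w ^ 4)⁻¹ * (w ^ 2 * ρ) ^ (1 / (r + 1)) < 1 + (w ^ 4)⁻¹ := by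
  obtain ⟨hl0, hK⟩ := invHarmonic_log_ineq hw hr hV ρ hρ
  have hV0 : 0 < V := lt_of_lt_of_le (by have : 0 < w ^ 2 - 1 := by nlinarith
                                         positivity) hV
  have hw0 : 0 < w := by linarith
  have hρ0 : 0 < ρ := by rw [hρ]; positivity
  have hr1 : 0 < r + 1 := by linarith
  have hr2 : 0 < r - 1 := by linarith
  have hlw0 : 0 < Real.log w := Real.log_pos hw
  set b := (w ^ 2 * ρ) ^ (1 / (r + 1)) with hb
  have hb0 : 0 < b := by positivity
  have hlb : (r + 1) * Real.log b = 2 * Real.log w + Real.log ρ := by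
    rw [hb, Real.log_rpow (by positivity), Real.log_mul (by positivity) (by positivity),
      Real.log_pow]
    field_simp
    push_cast
    ring
  -- Weighted AM-GM for `w`, `ρ`, `1`; the weight of `1` is nonnegative because `r ≥ 2`.
  have hble : (r + 1) * b ≤ 2 * w + ρ + (r - 2) := by
    have h := Real.geom_mean_le_arith_mean3_weighted (w₁ := 2 / (r + 1)) (w₂ := 1 / (r + 1))
      (w₃ := (r - 2) / (r + 1)) (p₁ := w) (p₂ := ρ) (p₃ := 1) (by positivity) (by positivity)
      (div_nonneg (by linarith) hr1.le) hw0.le hρ0.le zero_le_one (by field_simp; ring)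
    rw [Real.one_rpow, mul_one] at h
    have h' : b = w ^ (2 / (r + 1)) * ρ ^ (1 / (r + 1)) := by
      rw [hb, Real.mul_rpow (by positivity) hρ0.le, ← Real.rpow_natCast, ← Real.rpow_mul hw0.le]
      congr 2
      push_cast
      ring
    rw [← h'] at h
    calc (r + 1) * b ≤ (r + 1) * _ := mul_le_mul_of_nonneg_left h hr1.le
      _ = _ := by field_simp
  set l := Real.log ρ with hl
  set y := (w ^ 4)⁻¹ with hy
  have hy0 : 0 < y := by positivity
  have hyw : y * w ^ 4 = 1 := inv_mul_cancel₀ (by positivity)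
  have h1 : (r + 1) * b * (2 * r * l + (r - 1) * (2 * Real.log w)) < l * (r + 1) ^ 2 * (w ^ 4 + 1) :=
    lt_of_le_of_lt (mul_le_mul_of_nonneg_right hble (by positivity)) hK
  have h2 : y * b * (2 * r * l + (r - 1) * (2 * Real.log w)) < l * (r + 1) * (1 + y) := by
    refine lt_of_mul_lt_mul_left ?_ hr1.le
    calc (r + 1) * (y * b * (2 * r * l + (r - 1) * (2 * Real.log w)))
        = y * ((r + 1) * b * (2 * r * l + (r - 1) * (2 * Real.log w))) := by ring
      _ < y * (l * (r + 1) ^ 2 * (w ^ 4 + 1)) := mul_lt_mul_of_pos_left h1 hy0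
      _ = l * (r + 1) ^ 2 * (y * w ^ 4 + y) := by ring
      _ = _ := by rw [hyw]; ring
  set Y := 1 + y - y * b with hY
  have h3 : (r - 1) * Real.log b * (y * b) < l * Y := by
    refine lt_of_mul_lt_mul_left ?_ hr1.le
    calc (r + 1) * ((r - 1) * Real.log b * (y * b))
        = (r - 1) * (y * b) * ((r + 1) * Real.log b) := by ring
      _ = (r - 1) * (y * b) * (2 * Real.log w + l) := by rw [hlb]
      _ < (r + 1) * (l * Y) := by rw [hY]; linarith
  have hlb0 : 0 < Real.log b := pos_of_mul_pos_right (by rw [hlb]; positivity) hr1.le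
  have hY0 : 0 < Y := pos_of_mul_pos_right (lt_trans (by positivity) h3) hl0.le
  -- Since `Y + y * b = 1 + y`, this bound and `y` times the one for `b` add up to `h6`, with
  -- constants cancelling.
  have h4 : Y - 1 ≤ Y * Real.log Y := by
    have := mul_le_mul_of_nonneg_left (Real.one_sub_inv_le_log_of_pos hY0) hY0.le
    rwa [mul_sub, mul_one, mul_inv_cancel₀ hY0.ne'] at this
  have h5 : b - 1 ≤ b * Real.log b := by
    have := mul_le_mul_of_nonneg_left (Real.one_sub_inv_le_log_of_pos hb0) hb0.le
    rwa [mul_sub, mul_one, mul_inv_cancel₀ hb0.ne'] at this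
  have h6 : 0 ≤ Y * Real.log Y + y * (b * Real.log b) := by
    have := mul_le_mul_of_nonneg_left h5 hy0.le
    linarith
  have h7 : -l < (r - 1) * Real.log Y := by
    refine lt_of_mul_lt_mul_right ?_ hY0.le
    have := mul_le_mul_of_nonneg_left h6 hr2.le
    linarith
  have h8 : ρ⁻¹ ^ (1 / (r - 1)) < Y := by
    rw [← Real.log_lt_log_iff (by positivity) hY0, Real.log_rpow (by positivity), Real.log_inv,
      one_div_mul_eq_div, div_lt_iff₀ hr2, mul_comm]
    exact h7
  rw [hY] at h8
  linarith

/-! ### Symmetry and homogeneity of the means -/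

theorem genInvHarmonicMean_comm (r : EReal) (a b : ℝ) :
    genInvHarmonicMean r a b = genInvHarmonicMean r b a := by
  simp only [genInvHarmonicMean, max_comm a b, min_comm a b, add_comm, mul_comm]

theorem genInvHarmonicMean_coe {r : ℝ} (hr : r ≠ 1) (a b : ℝ) :
    genInvHarmonicMean (r : EReal) a b = ((b ^ r + a ^ r) / (b + a)) ^ (1 / (r - 1)) := by
  simp [genInvHarmonicMean, hr]

theorem genInvHarmonicMean_one (a b : ℝ) :
    genInvHarmonicMean ((1 : ℝ) : EReal) a b = (b ^ b * a ^ a) ^ (1 / (b + a)) := by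
  rw [genInvHarmonicMean, if_neg (EReal.coe_ne_top 1), if_neg (EReal.coe_ne_bot 1),
    if_pos EReal.coe_one]

theorem genInvHarmonicMean_coe_mul (r : ℝ) {c a b : ℝ} (hc : 0 < c) (ha : 0 < a) (hb : 0 < b) :
    genInvHarmonicMean (r : EReal) (c * a) (c * b) = c * genInvHarmonicMean (r : EReal) a b := by
  rcases eq_or_ne r 1 with rfl | hr
  · have hab : b + a ≠ 0 := by positivity
    have h : (c * b) ^ (c * b) * (c * a) ^ (c * a) = (c ^ (b + a) * (b ^ b * a ^ a)) ^ c := by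
      rw [Real.mul_rpow hc.le hb.le, Real.mul_rpow hc.le ha.le,
        Real.mul_rpow (by positivity) (by positivity), Real.mul_rpow (by positivity) (by positivity),
        ← Real.rpow_mul hc.le, ← Real.rpow_mul hb.le, ← Real.rpow_mul ha.le, mul_comm b c,
        mul_comm a c, show (b + a) * c = c * b + c * a by ring, Real.rpow_add hc]
      ring
    rw [genInvHarmonicMean_one, genInvHarmonicMean_one, h, ← Real.rpow_mul (by positivity),
      show c * (1 / (c * b + c * a)) = 1 / (b + a) by field_simp,
      Real.mul_rpow (by positivity) (by positivity), ← Real.rpow_mul hc.le, mul_one_div_cancel hab,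
      Real.rpow_one]
  · have hr' : r - 1 ≠ 0 := sub_ne_zero.2 hr
    have h : ((c * b) ^ r + (c * a) ^ r) / (c * b + c * a) =
        c ^ (r - 1) * ((b ^ r + a ^ r) / (b + a)) := by
      rw [Real.mul_rpow hc.le hb.le, Real.mul_rpow hc.le ha.le, Real.rpow_sub_one hc.ne']
      field_simp
    rw [genInvHarmonicMean_coe hr, genInvHarmonicMean_coe hr, h,
      Real.mul_rpow (by positivity) (by positivity), ← Real.rpow_mul hc.le, mul_one_div_cancel hr',
      Real.rpow_one]

/-! ### Comparison of means for `r ≤ 2` -/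

/-- This is `C_1 ≤ C_2`, by weighted AM-GM; parameters below `1` are compared with `C_2` through
`C_1`. -/
theorem rpow_self_weighted_le {x : ℝ} (hx : 0 < x) :
    x ^ (x / (1 + x)) ≤ (1 + x ^ 2) / (1 + x) := by
  have h := Real.geom_mean_le_arith_mean2_weighted (w₁ := 1 / (1 + x)) (w₂ := x / (1 + x))
    (p₁ := 1) (p₂ := x) (by positivity) (by positivity) zero_le_one hx.le (by field_simp)
  rw [Real.one_rpow, one_mul] at h
  exact h.trans_eq (by field_simp)

/-- The mean of parameter `r ≤ 2` is at most the mean of parameter `2`. -/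
theorem genInvHarmonicMean_le_two {r x : ℝ} (hr : r ≤ 2) (hx : 0 < x) :
    genInvHarmonicMean (r : EReal) x 1 ≤ (1 + x ^ 2) / (1 + x) := by
  rcases lt_trichotomy r 1 with h | rfl | h
  · have hr1 : r - 1 < 0 := by linarith
    rw [genInvHarmonicMean_coe h.ne, Real.one_rpow]
    refine le_trans ?_ (rpow_self_weighted_le hx)
    have h1 := Real.geom_mean_le_arith_mean2_weighted (w₁ := 1 / (1 + x)) (w₂ := x / (1 + x))
      (p₁ := 1) (p₂ := x ^ (r - 1)) (by positivity) (by positivity) zero_le_one (by positivity)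
      (by field_simp)
    have h2 : 1 / (1 + x) * 1 + x / (1 + x) * x ^ (r - 1) = (1 + x ^ r) / (1 + x) := by
      rw [Real.rpow_sub_one hx.ne']
      field_simp
    rw [Real.one_rpow, one_mul, h2] at h1
    calc ((1 + x ^ r) / (1 + x)) ^ (1 / (r - 1))
        ≤ ((x ^ (r - 1)) ^ (x / (1 + x))) ^ (1 / (r - 1)) :=
          Real.rpow_le_rpow_of_nonpos (by positivity) h1 (one_div_nonpos.2 hr1.le)
      _ = x ^ (x / (1 + x)) := by
          rw [← Real.rpow_mul hx.le, ← Real.rpow_mul hx.le]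
          congr 1
          field_simp [hr1.ne]
  · rw [genInvHarmonicMean_one, Real.one_rpow, one_mul, ← Real.rpow_mul hx.le, mul_one_div]
    exact rpow_self_weighted_le hx
  · have hr1 : 0 < r - 1 := by linarith
    rw [genInvHarmonicMean_coe h.ne', Real.one_rpow, one_div (r - 1),
      Real.rpow_inv_le_iff_of_pos (by positivity) (by positivity) hr1]
    -- Jensen for the concave `t ^ (r - 1)`, with `0 < r - 1 ≤ 1`.
    have h1 := (Real.concaveOn_rpow hr1.le (by linarith)).2 (Set.mem_Ici.2 zero_le_one)
      (Set.mem_Ici.2 hx.le) (show 0 ≤ 1 / (1 + x) by positivity)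
      (show 0 ≤ x / (1 + x) by positivity) (by field_simp)
    simp only [smul_eq_mul, Real.one_rpow] at h1
    rw [Real.rpow_sub_one hx.ne'] at h1
    calc (1 + x ^ r) / (1 + x) = 1 / (1 + x) * 1 + x / (1 + x) * (x ^ r / x) := by field_simp
      _ ≤ _ := h1
      _ = _ := by congr 1; field_simp

/-- The mean of parameter `-r ≤ 0` is at most the mean of parameter `0`. -/
theorem genInvHarmonicMean_neg_le {r x : ℝ} (hr : 0 ≤ r) (hx : 0 < x) :
    genInvHarmonicMean ((-r : ℝ) : EReal) x 1 ≤ (1 + x) / 2 := by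
  have hr1 : 0 < r + 1 := by linarith
  rw [genInvHarmonicMean_coe (by linarith), Real.one_rpow]
  -- Jensen for `t ^ (r + 1)` at `1` and `x⁻¹`, whose weighted mean is `2 / (1 + x)`.
  have h1 := (convexOn_rpow (p := r + 1) (by linarith)).2 (Set.mem_Ici.2 zero_le_one)
      (Set.mem_Ici.2 (inv_pos.2 hx).le) (show 0 ≤ 1 / (1 + x) by positivity)
      (show 0 ≤ x / (1 + x) by positivity) (by field_simp)
  simp only [smul_eq_mul, Real.one_rpow] at h1
  have h2 : 1 / (1 + x) * 1 + x / (1 + x) * x⁻¹ ^ (r + 1) = (1 + x ^ (-r)) / (1 + x) := by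
    rw [Real.inv_rpow hx.le, ← Real.rpow_neg hx.le, neg_add', Real.rpow_sub_one hx.ne']
    field_simp
  have h3 : 1 / (1 + x) * 1 + x / (1 + x) * x⁻¹ = ((1 + x) / 2)⁻¹ := by
    field_simp
    norm_num
  rw [h2, h3] at h1
  calc ((1 + x ^ (-r)) / (1 + x)) ^ (1 / (-r - 1))
      ≤ (((1 + x) / 2)⁻¹ ^ (r + 1)) ^ (1 / (-r - 1)) :=
        Real.rpow_le_rpow_of_nonpos (by positivity) h1 (one_div_nonpos.2 (by linarith))
    _ = (1 + x) / 2 := by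
        rw [← Real.rpow_mul (by positivity),
          show (r + 1) * (1 / (-r - 1)) = -1 by
            rw [show -r - 1 = -(r + 1) by ring]; field_simp,
          Real.rpow_neg_one, inv_inv]

/-! ### The case `r ≥ 2` and assembly -/

theorem genInvHarmonicMean_add_lt_of_two_le {r x : ℝ} (hr : 2 ≤ r) (hx : 0 < x) (hx1 : x < 1) :
    genInvHarmonicMean (r : EReal) x 1 + x * genInvHarmonicMean ((-r : ℝ) : EReal) x 1
      < 1 + x ^ 2 := by
  obtain ⟨w, hw, rfl⟩ : ∃ w : ℝ, 1 < w ∧ x = (w ^ 2)⁻¹ := by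
    refine ⟨(√x)⁻¹, (one_lt_inv₀ (Real.sqrt_pos.2 hx)).2 ?_, ?_⟩
    · rwa [Real.sqrt_lt' one_pos, one_pow]
    · rw [inv_pow, inv_inv, Real.sq_sqrt hx.le]
  have hw0 : 0 < w := by linarith
  set V := (w ^ 2) ^ r with hVdef
  have hV0 : 0 < V := by positivity
  have hV : (1 + r / 2 * (w ^ 2 - 1)) ^ 2 ≤ V := by
    have hu : 0 < w ^ 2 - 1 := by nlinarith
    -- Bernoulli with exponent `r / 2 ≥ 1`, then squared, gives a bound quadratic in `r`.
    have h := one_add_mul_self_le_rpow_one_add (s := w ^ 2 - 1) (by linarith) (p := r / 2)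
      (by linarith)
    rw [add_sub_cancel] at h
    calc (1 + r / 2 * (w ^ 2 - 1)) ^ 2 ≤ ((w ^ 2) ^ (r / 2)) ^ 2 :=
          pow_le_pow_left₀ (by positivity) h 2
      _ = V := by
          rw [← Real.rpow_natCast, ← Real.rpow_mul (by positivity), hVdef]
          congr 1
          push_cast
          ring
  have main := invHarmonic_rpow_lt hw hr hV _ rfl
  set ρ := (w ^ 2 + 1) * V / (w ^ 2 * (V + 1)) with hρ
  have hρ0 : 0 < ρ := by positivity
  have hr1 : 0 < r + 1 := by linarith
  have hv : ((w ^ 2)⁻¹ : ℝ) ^ r = V⁻¹ := Real.inv_rpow (by positivity) r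
  have hA : genInvHarmonicMean (r : EReal) (w ^ 2)⁻¹ 1 = ρ⁻¹ ^ (1 / (r - 1)) := by
    rw [genInvHarmonicMean_coe (by linarith), Real.one_rpow, hv, hρ]
    congr 1
    field_simp
  have hB : genInvHarmonicMean ((-r : ℝ) : EReal) (w ^ 2)⁻¹ 1 =
      (w ^ 2)⁻¹ * (w ^ 2 * ρ) ^ (1 / (r + 1)) := by
    rw [genInvHarmonicMean_coe (by linarith), Real.one_rpow, Real.rpow_neg (by positivity), hv,
      inv_inv]
    have h1 : (1 + V) / (1 + (w ^ 2)⁻¹) = ((w ^ 2)⁻¹ ^ (r + 1) * (w ^ 2 * ρ))⁻¹ := by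
      rw [Real.rpow_add_one (by positivity), hv, hρ]
      field_simp
      ring
    rw [h1, show 1 / (-r - 1) = -(1 / (r + 1)) by rw [← div_neg]; ring_nf,
      Real.rpow_neg (by positivity), Real.inv_rpow (by positivity), inv_inv,
      Real.mul_rpow (by positivity) (by positivity), ← Real.rpow_mul (by positivity),
      mul_one_div_cancel hr1.ne', Real.rpow_one]
  have h4 : (w ^ 4)⁻¹ = (w ^ 2)⁻¹ ^ 2 := by rw [inv_pow]; ring
  rw [hA, hB, ← mul_assoc, ← sq, ← h4]
  exact main

theorem genInvHarmonicMean_add_lt {r x : ℝ} (hr : 0 ≤ r) (hx : 0 < x) (hx1 : x < 1) :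
    genInvHarmonicMean (r : EReal) x 1 + x * genInvHarmonicMean ((-r : ℝ) : EReal) x 1
      < 1 + x ^ 2 := by
  rcases le_total 2 r with h | h
  · exact genInvHarmonicMean_add_lt_of_two_le h hx hx1
  · have h1 := genInvHarmonicMean_le_two h hx
    have h2 := genInvHarmonicMean_neg_le hr hx
    have h3 : (1 + x) / 2 < (1 + x ^ 2) / (1 + x) := by
      rw [div_lt_div_iff₀ two_pos (by linarith)]
      nlinarith [mul_pos (sub_pos.2 hx1) (sub_pos.2 hx1)]
    calc _ < (1 + x ^ 2) / (1 + x) + x * ((1 + x ^ 2) / (1 + x)) :=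
          add_lt_add_of_le_of_lt h1 (mul_lt_mul_of_pos_left (h2.trans_lt h3) hx)
      _ = 1 + x ^ 2 := by field_simp

theorem genInvHarmonicMean_main_of_lt {r a b : ℝ} (hr : 0 ≤ r) (ha : 0 < a) (hab : a < b) :
    b * genInvHarmonicMean (r : EReal) a b + a * genInvHarmonicMean ((-r : ℝ) : EReal) a b
      < a ^ 2 + b ^ 2 := by
  have hb : 0 < b := ha.trans hab
  obtain ⟨x, hx, hx1, rfl⟩ : ∃ x, 0 < x ∧ x < 1 ∧ a = b * x :=
    ⟨a / b, div_pos ha hb, (div_lt_one hb).2 hab, by field_simp⟩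
  have h (s : ℝ) := genInvHarmonicMean_coe_mul s hb hx one_pos
  rw [mul_one] at h
  rw [h, h]
  have := mul_lt_mul_of_pos_left (genInvHarmonicMean_add_lt hr hx hx1) (pow_pos hb 2)
  linarith

theorem corollary4p3 (r : ℝ) (hr : 0 ≤ r) (a b : ℝ) (ha : 0 < a) (hb : 0 < b) (hab : a ≠ b) :
    genInvHarmonicMean ⊤ a b * genInvHarmonicMean (r : EReal) a b
      + genInvHarmonicMean ⊥ a b * genInvHarmonicMean ((-r : ℝ) : EReal) a b
      < a ^ 2 + b ^ 2 := by
  have htop : genInvHarmonicMean ⊤ a b = max a b := by simp [genInvHarmonicMean]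
  have hbot : genInvHarmonicMean ⊥ a b = min a b := by simp [genInvHarmonicMean]
  rw [htop, hbot]
  rcases hab.lt_or_gt with h | h
  · rw [max_eq_right h.le, min_eq_left h.le]
    exact genInvHarmonicMean_main_of_lt hr ha h
  · rw [max_eq_left h.le, min_eq_right h.le, genInvHarmonicMean_comm r,
      genInvHarmonicMean_comm ((-r : ℝ) : EReal), add_comm (a ^ 2)]
    exact genInvHarmonicMean_main_of_lt hr hb h
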